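/- A groupoid $\mathscr G$ is a small category in which every arrow is invertible; we identify it with its set of arrows, write $\boldsymbol d(g)=g^{-1}g$ and $\boldsymbol r(g)=gg^{-1}$ for source and range, and let $\mathscr G^{(0)}=\{gg^{-1}: g\in\mathscr G\}$ be the unit space. A topological groupoid is a groupoid with a topology on $\mathscr G$ making multiplication and inversion continuous; $\mathscr G^{(0)}$ carries the subspace topology. It is *ample* if $\mathscr G^{(0)}$ is locally compact and Hausdorff, $\boldsymbol r:\mathscr G\to\mathscr G^{(0)}$ is a local homeomorphism, and $\mathscr G^{(0)}$ has a basis of compact open sets. It is *minimal* if the only open subsets $U\subseteq \mathscr G^{(0)}$ that are invariant (that is, $\boldsymbol d(g)\in U\iff \boldsymbol r(g)\in U$ for all $g\in\mathscr G$) are $\emptyset$ and $\mathscr G^{(0)}$. It is *effective* if $\mathscr G^{(0)}$ equals the interior in $\mathscr G$ of $\mathrm{Iso}(\mathscr G)=\{g\in\mathscr G:\boldsymbol d(g)=\boldsymbol r(g)\}$. **Theorem.** Let $\mathscr G$ be a nonempty ample groupoid whose arrow space is Hausdorff, and let $C_c(\mathscr G)$ be the algebra of compactly supported continuous functions $\mathscr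 G\to\mathbb C$ with pointwise linear structure and convolution product $(f*g)(\gamma)=\sum_{\alpha\beta=\gamma}f(\alpha)g(\beta)$. Then $C_c(\mathscr G)$ is simple as a ring (it is nonzero and its only two-sided ideals are $\{0\}$ and $C_c(\mathscr G)$) if and only if $\mathscr G$ is minimal and effective. -/

import Mathlib

namespace AmpleGroupoid

open CategoryTheory Topology Set
open scoped CompactlySupported

universe v u

/-! ### The arrow space of a groupoid -/

section Algebra

variable {X : Type u} [Groupoid.{v} X]

variable (X) in
/-- The set of all arrows of the groupoid with object set `X`. -/
abbrev Arr : Type max u v := Quiver.Total X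

/-- The source of an arrow, regarded as an identity arrow. -/
def d (g : Arr X) : Arr X := ⟨g.left, g.left, 𝟙 g.left⟩

/-- The range of an arrow, regarded as an identity arrow. -/
def r (g : Arr X) : Arr X := ⟨g.right, g.right, 𝟙 g.right⟩

/-- The inverse of an arrow. -/
instance instInvArr : Inv (Arr X) := ⟨fun g => ⟨g.right, g.left, Groupoid.inv g.hom⟩⟩

open Classical in
/-- The product `a * b` of arrows, meaning "first `b`, then `a`". It is the groupoid product
when `d a = r b`; its value in the other case is irrelevant and never used. -/
noncomputable instance instMulArr : Mul (Arr X) :=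
  ⟨fun a b => if h : b.right = a.left then ⟨b.left, a.right, b.hom ≫ eqToHom h ≫ a.hom⟩ else a⟩

theorem d_eq_r_iff {a b : Arr X} : d a = r b ↔ b.right = a.left := by
  constructor
  · intro h
    exact (congrArg Quiver.Total.left h).symm
  · intro h
    obtain ⟨y, z, q⟩ := a
    obtain ⟨x, y', p⟩ := b
    obtain rfl : y' = y := h
    rfl

theorem mul_mk {x y z : X} (q : y ⟶ z) (p : x ⟶ y) :
    (⟨y, z, q⟩ * ⟨x, y, p⟩ : Arr X) = ⟨x, z, p ≫ q⟩ := by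
  refine (dif_pos rfl).trans ?_
  simp

theorem inv_mk {x y : X} (p : x ⟶ y) : (⟨x, y, p⟩⁻¹ : Arr X) = ⟨y, x, Groupoid.inv p⟩ := rfl

theorem r_eq (g : Arr X) : r g = g * g⁻¹ := by
  obtain ⟨x, y, p⟩ := g
  rw [inv_mk, mul_mk]
  simp [r]

theorem d_eq (g : Arr X) : d g = g⁻¹ * g := by
  obtain ⟨x, y, p⟩ := g
  rw [inv_mk, mul_mk]
  simp [d]

@[simp] theorem d_inv (g : Arr X) : d g⁻¹ = r g := rfl
@[simp] theorem r_inv (g : Arr X) : r g⁻¹ = d g := rfl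
@[simp] theorem r_r (g : Arr X) : r (r g) = r g := rfl
@[simp] theorem r_d (g : Arr X) : r (d g) = d g := rfl
@[simp] theorem d_r (g : Arr X) : d (r g) = r g := rfl
@[simp] theorem d_d (g : Arr X) : d (d g) = d g := rfl

/-- Composable arrows come from composable morphisms. -/
theorem exists_of_composable {a b : Arr X} (h : d a = r b) :
    ∃ (x y z : X) (p : x ⟶ y) (q : y ⟶ z), a = ⟨y, z, q⟩ ∧ b = ⟨x, y, p⟩ := by
  obtain ⟨y, z, q⟩ := a
  obtain ⟨x, y', p⟩ := b
  obtain rfl : y' = y := d_eq_r_iff.1 h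
  exact ⟨_, _, _, p, q, rfl, rfl⟩

theorem d_mul {a b : Arr X} (h : d a = r b) : d (a * b) = d b := by
  obtain ⟨x, y, z, p, q, rfl, rfl⟩ := exists_of_composable h
  rw [mul_mk]; rfl

theorem r_mul {a b : Arr X} (h : d a = r b) : r (a * b) = r a := by
  obtain ⟨x, y, z, p, q, rfl, rfl⟩ := exists_of_composable h
  rw [mul_mk]; rfl

theorem mul_assoc' {a b c : Arr X} (h : d a = r b) (h' : d b = r c) :
    a * b * c = a * (b * c) := by
  obtain ⟨x, y, z, p, q, rfl, rfl⟩ := exists_of_composable h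
  obtain ⟨w, y', p'⟩ := c
  obtain rfl : y' = x := d_eq_r_iff.1 h'
  simp only [mul_mk, Category.assoc]

theorem inv_mul_cancel_left' {a b : Arr X} (h : d a = r b) : a⁻¹ * (a * b) = b := by
  obtain ⟨x, y, z, p, q, rfl, rfl⟩ := exists_of_composable h
  simp [mul_mk, inv_mk]

theorem mul_inv_cancel_left' {a b : Arr X} (h : r a = r b) : a * (a⁻¹ * b) = b := by
  have := inv_mul_cancel_left' (a := a⁻¹) (b := b) h
  obtain ⟨x, y, p⟩ := a
  simpa [inv_mk] using this

theorem inv_inv' (a : Arr X) : a⁻¹⁻¹ = a := by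
  obtain ⟨x, y, p⟩ := a
  simp [inv_mk]

theorem mul_inv_rev' {a b : Arr X} (h : d a = r b) : (a * b)⁻¹ = b⁻¹ * a⁻¹ := by
  obtain ⟨x, y, z, p, q, rfl, rfl⟩ := exists_of_composable h
  simp [mul_mk, inv_mk]

variable (X) in
/-- The unit space: the set of identity arrows `g * g⁻¹`. -/
def unitSpace : Set (Arr X) := Set.range (r : Arr X → Arr X)

/-- The source map as a map onto the unit space. -/
def dMap (g : Arr X) : unitSpace X := ⟨d g, d g, rfl⟩

/-- The range map as a map onto the unit space. -/
def rMap (g : Arr X) : unitSpace X := ⟨r g, g, rfl⟩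

theorem rMap_eq_iff {a b : Arr X} : rMap a = rMap b ↔ r a = r b := Subtype.ext_iff

variable (X) in
/-- The isotropy subgroupoid. -/
def iso : Set (Arr X) := {g | d g = r g}

/-- A set of units is invariant if it contains the source of an arrow exactly when it contains
its range. -/
def IsInvariant (D : Set (unitSpace X)) : Prop := ∀ g : Arr X, dMap g ∈ D ↔ rMap g ∈ D

/-- Convolution: `(f * g)(γ) = ∑ f(α) g(β)` over all composable pairs with `α * β = γ`; such a pair
is `(α, α⁻¹ * γ)` with `r α = r γ`. -/
noncomputable def conv (f g : Arr X → ℂ) (γ : Arr X) : ℂ :=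
  ∑ᶠ α ∈ {α : Arr X | r α = r γ}, f α * g (α⁻¹ * γ)

/-- The convolution is the sum over all factorizations. -/
theorem conv_eq (f g : Arr X → ℂ) (γ : Arr X) :
    conv f g γ = ∑ᶠ p ∈ {p : Arr X × Arr X | d p.1 = r p.2 ∧ p.1 * p.2 = γ}, f p.1 * g p.2 := by
  symm
  refine finsum_mem_eq_of_bijOn Prod.fst ⟨?_, ?_, ?_⟩ ?_
  · rintro ⟨a, b⟩ ⟨h, rfl⟩
    exact (r_mul h).symm
  · rintro ⟨a, b⟩ ⟨h, h1⟩ ⟨a', b'⟩ ⟨h', h1'⟩ (rfl : a = a')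
    simp only at h h' h1 h1'
    rw [Prod.mk.injEq]
    exact ⟨rfl, by rw [← inv_mul_cancel_left' h, ← inv_mul_cancel_left' h', h1, h1']⟩
  · intro a ha
    have ha' : r a = r γ := ha
    refine ⟨(a, a⁻¹ * γ), ⟨?_, mul_inv_cancel_left' ha'⟩, rfl⟩
    change d a = r (a⁻¹ * γ)
    rw [r_mul (by simpa using ha'), r_inv]
  · rintro ⟨a, b⟩ ⟨h, rfl⟩
    change f a * g b = f a * g (a⁻¹ * (a * b))
    rw [inv_mul_cancel_left' h]

theorem conv_eq_sum {f g : Arr X → ℂ} {γ : Arr X} (S : Finset (Arr X))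
    (hS : ∀ a ∈ S, r a = r γ) (h : ∀ a, r a = r γ → f a * g (a⁻¹ * γ) ≠ 0 → a ∈ S) :
    conv f g γ = ∑ a ∈ S, f a * g (a⁻¹ * γ) := by
  refine finsum_mem_eq_sum_of_inter_support_eq _ ?_
  ext a
  exact ⟨fun ha => ⟨h a ha.1 ha.2, ha.2⟩, fun ha => ⟨hS a ha.1, ha.2⟩⟩

end Algebra

/-! ### Topological, étale and ample groupoids -/

section Topological

variable (X : Type u) [Groupoid.{v} X] [TopologicalSpace (Arr X)]

/-- A topological groupoid: the product of composable arrows and the inverse are continuous. -/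
class IsTopologicalGroupoid : Prop where
  continuousOn_mul :
    ContinuousOn (fun p : Arr X × Arr X => p.1 * p.2) {p : Arr X × Arr X | d p.1 = r p.2}
  continuous_inv : Continuous (fun g : Arr X => g⁻¹)

/-- An étale groupoid: the unit space is locally compact and Hausdorff, and the range map is a
local homeomorphism onto the unit space. -/
class IsEtaleGroupoid : Prop extends IsTopologicalGroupoid X where
  locallyCompact_unitSpace : LocallyCompactSpace (unitSpace X)
  t2_unitSpace : T2Space (unitSpace X)
  isLocalHomeomorph_rMap : IsLocalHomeomorph (rMap : Arr X → unitSpace X)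

/-- An ample groupoid: an étale groupoid whose unit space has a basis of compact open sets. -/
class IsAmpleGroupoid : Prop extends IsEtaleGroupoid X where
  isTopologicalBasis_compactOpen :
    TopologicalSpace.IsTopologicalBasis {U : Set (unitSpace X) | IsCompact U ∧ IsOpen U}

/-- A groupoid is minimal if the only open invariant subsets of its unit space are the empty set
and the whole unit space. -/
def IsMinimal : Prop :=
  ∀ U : Set (unitSpace X), IsOpen U → IsInvariant U → U = ∅ ∨ U = Set.univ

/-- A groupoid is effective if its unit space is the interior of its isotropy subgroupoid. -/
def IsEffective : Prop := unitSpace X = interior (iso X)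

/-- The space `C_c(𝒢)` of compactly supported continuous complex functions on the arrow space. It
carries the pointwise vector space structure, and the convolution product (defined below). -/
def ConvAlg : Type max u v := C_c(Arr X, ℂ)

end Topological

section Convolution

variable {X : Type u} [Groupoid.{v} X] [TopologicalSpace (Arr X)]

namespace ConvAlg

instance : FunLike (ConvAlg X) (Arr X) ℂ := inferInstanceAs (FunLike C_c(Arr X, ℂ) (Arr X) ℂ)
noncomputable instance : AddCommGroup (ConvAlg X) := inferInstanceAs (AddCommGroup C_c(Arr X, ℂ))
noncomputable instance : Module ℂ (ConvAlg X) := inferInstanceAs (Module ℂ C_c(Arr X, ℂ))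

@[ext] theorem ext {f g : ConvAlg X} (h : ∀ x, f x = g x) : f = g := DFunLike.ext _ _ h
@[simp] theorem add_apply (f g : ConvAlg X) (x : Arr X) : (f + g) x = f x + g x := rfl
@[simp] theorem zero_apply (x : Arr X) : (0 : ConvAlg X) x = 0 := rfl
@[simp] theorem smul_apply (c : ℂ) (f : ConvAlg X) (x : Arr X) : (c • f) x = c * f x := rfl

theorem continuous (f : ConvAlg X) : Continuous f :=
  f.toContinuousMap.continuous_toFun
theorem hasCompactSupport (f : ConvAlg X) : HasCompactSupport f :=
  CompactlySupportedContinuousMap.hasCompactSupport' f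

end ConvAlg

theorem continuous_r [IsTopologicalGroupoid X] : Continuous (r : Arr X → Arr X) := by
  have h : (r : Arr X → Arr X) = (fun p : Arr X × Arr X => p.1 * p.2) ∘ fun g => (g, g⁻¹) := by
    ext1 g; exact r_eq g
  rw [h]
  exact IsTopologicalGroupoid.continuousOn_mul.comp_continuous
    (continuous_id.prodMk IsTopologicalGroupoid.continuous_inv) (fun g => rfl)

theorem continuous_d [IsTopologicalGroupoid X] : Continuous (d : Arr X → Arr X) :=
  continuous_r.comp (IsTopologicalGroupoid.continuous_inv (X := X))

/-- A compact set meets every fibre of the range map in a finite set. -/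
theorem finite_fibre [IsEtaleGroupoid X] [T2Space (Arr X)] {K : Set (Arr X)} (hK : IsCompact K)
    (u : Arr X) : {a | a ∈ K ∧ r a = r u}.Finite := by
  have hc : IsCompact {a | a ∈ K ∧ r a = r u} :=
    hK.inter_right (isClosed_eq continuous_r continuous_const)
  choose e he heq using IsEtaleGroupoid.isLocalHomeomorph_rMap (X := X)
  obtain ⟨t, ht', ht⟩ := hc.elim_nhds_subcover (fun a => (e a).source)
    (fun a _ => (e a).open_source.mem_nhds (he a))
  refine t.finite_toSet.subset fun a ha => ?_
  obtain ⟨b, hb, hab⟩ := Set.mem_iUnion₂.1 (ht ha)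
  have : a = b := (e b).injOn hab (he b) (by
    rw [← heq b]
    exact rMap_eq_iff.2 (ha.2.trans (ht' b hb).2.symm))
  exact this ▸ hb

theorem finite_support_fibre [IsEtaleGroupoid X] [T2Space (Arr X)] (f : ConvAlg X) (u : Arr X) :
    {a | f a ≠ 0 ∧ r a = r u}.Finite :=
  (finite_fibre f.hasCompactSupport u).subset fun _ ha => ⟨subset_tsupport _ ha.1, ha.2⟩

/-- The product set of two compact sets of arrows is compact. -/
theorem isCompact_mul [IsTopologicalGroupoid X] [T2Space (Arr X)] {K L : Set (Arr X)}
    (hK : IsCompact K) (hL : IsCompact L) :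
    IsCompact ((fun p : Arr X × Arr X => p.1 * p.2) ''
      ((K ×ˢ L) ∩ {p : Arr X × Arr X | d p.1 = r p.2})) := by
  refine IsCompact.image_of_continuousOn ?_
    (IsTopologicalGroupoid.continuousOn_mul.mono Set.inter_subset_right)
  exact (hK.prod hL).inter_right
    (isClosed_eq (continuous_d.comp continuous_fst) (continuous_r.comp continuous_snd))

theorem hasCompactSupport_conv [IsEtaleGroupoid X] [T2Space (Arr X)] (f g : ConvAlg X) :
    HasCompactSupport (conv f g) := by
  refine HasCompactSupport.of_support_subset_isCompact
    (isCompact_mul f.hasCompactSupport g.hasCompactSupport) fun γ hγ => ?_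
  obtain ⟨a, ha, hne⟩ := exists_ne_zero_of_finsum_mem_ne_zero hγ
  have ha' : r a = r γ := ha
  refine ⟨(a, a⁻¹ * γ), ⟨⟨subset_tsupport _ (left_ne_zero_of_mul hne),
    subset_tsupport _ (right_ne_zero_of_mul hne)⟩, ?_⟩, mul_inv_cancel_left' ha'⟩
  change d a = r (a⁻¹ * γ)
  rw [r_mul (by simpa using ha'), r_inv]

theorem continuous_conv [IsEtaleGroupoid X] [T2Space (Arr X)] (f g : ConvAlg X) :
    Continuous (conv f g) := by
  classical
  rw [continuous_iff_continuousAt]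
  intro γ₀
  have hlh := IsEtaleGroupoid.isLocalHomeomorph_rMap (X := X)
  have hr : Continuous (rMap : Arr X → unitSpace X) := hlh.continuous
  have := IsEtaleGroupoid.t2_unitSpace (X := X)
  choose e he heq using hlh
  have hF := finite_fibre f.hasCompactSupport γ₀
  obtain ⟨U, hU, hdisj⟩ := hF.t2_separation
  set F := hF.toFinset with hFdef
  have memF : ∀ a, a ∈ F ↔ a ∈ tsupport f ∧ r a = r γ₀ := fun a => by simp [hFdef]
  set W : Arr X → Set (Arr X) := fun a => U a ∩ (e a).source with hW
  have hWo : ∀ a, IsOpen (W a) := fun a => (hU a).2.inter (e a).open_source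
  have hC : IsCompact (tsupport f \ ⋃ a ∈ F, W a) :=
    IsCompact.diff f.hasCompactSupport (isOpen_biUnion fun a _ => hWo a)
  -- the neighbourhood of `γ₀` on which local sections compute the convolution
  have hN1 : ∀ᶠ γ in 𝓝 γ₀, rMap γ ∉ rMap '' (tsupport f \ ⋃ a ∈ F, W a) := by
    refine hr.continuousAt.eventually ((hC.image hr).isClosed.isOpen_compl.mem_nhds ?_)
    rintro ⟨a, ⟨ha, ha'⟩, h⟩
    have haF : a ∈ F := (memF a).2 ⟨ha, rMap_eq_iff.1 h⟩
    exact ha' (Set.mem_iUnion₂.2 ⟨a, haF, (hU a).1, he a⟩)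
  have hpt : ∀ a ∈ F, e a a = rMap γ₀ := fun a ha => by
    rw [← heq a]; exact rMap_eq_iff.2 ((memF a).1 ha).2
  have hN2 : ∀ᶠ γ in 𝓝 γ₀, ∀ a ∈ F, rMap γ ∈ e a '' W a := by
    rw [Filter.eventually_all_finset]
    intro a ha
    refine hr.continuousAt.eventually (IsOpen.mem_nhds ?_ ⟨a, ⟨(hU a).1, he a⟩, hpt a ha⟩)
    exact (e a).isOpen_image_of_subset_source (hWo a) Set.inter_subset_right
  set σ : Arr X → Arr X → Arr X := fun a γ => (e a).symm (rMap γ) with hσ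
  have hσr : ∀ {a γ}, rMap γ ∈ e a '' W a → r (σ a γ) = r γ ∧ σ a γ ∈ W a := by
    rintro a γ ⟨b, hb, hbe⟩
    have : σ a γ = b := by rw [hσ]; simp only; rw [← hbe, (e a).left_inv hb.2]
    rw [this]
    refine ⟨rMap_eq_iff.1 ?_, hb⟩
    rw [← hbe]
    exact congrFun (heq a) b
  have hev : ∀ᶠ γ in 𝓝 γ₀,
      conv f g γ = ∑ a ∈ F, f (σ a γ) * g ((σ a γ)⁻¹ * γ) := by
    filter_upwards [hN1, hN2] with γ h1 h2
    have hinj : Set.InjOn (fun a => σ a γ) F := by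
      intro a ha b hb hab
      by_contra hne
      have hd : Disjoint (U a) (U b) := hdisj (by simpa using (memF a).1 ha)
        (by simpa using (memF b).1 hb) hne
      refine Set.disjoint_left.1 hd (hσr (h2 a ha)).2.1 ?_
      have : σ a γ = σ b γ := hab
      rw [this]
      exact (hσr (h2 b hb)).2.1
    rw [conv_eq_sum (F.image fun a => σ a γ), Finset.sum_image hinj]
    · intro b hb
      obtain ⟨a, ha, rfl⟩ := Finset.mem_image.1 hb
      exact (hσr (h2 a ha)).1
    · intro b hb hne
      have hbs : b ∈ tsupport f := subset_tsupport _ (left_ne_zero_of_mul hne)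
      have hbW : b ∈ ⋃ a ∈ F, W a := by
        by_contra hcon
        exact h1 ⟨b, ⟨hbs, hcon⟩, rMap_eq_iff.2 hb⟩
      obtain ⟨a, ha, hba⟩ := Set.mem_iUnion₂.1 hbW
      refine Finset.mem_image.2 ⟨a, ha, ?_⟩
      refine (e a).injOn (hσr (h2 a ha)).2.2 hba.2 ?_
      rw [← heq a]
      exact rMap_eq_iff.2 ((hσr (h2 a ha)).1.trans hb.symm)
  refine ContinuousAt.congr ?_ (Filter.EventuallyEq.symm hev)
  refine tendsto_finsetSum _ fun a ha => ?_
  have hσc : ContinuousAt (σ a) γ₀ := by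
    refine ContinuousAt.comp (g := (e a).symm) ((e a).continuousAt_symm ?_) hr.continuousAt
    rw [← hpt a ha]
    exact (e a).map_source (he a)
  refine ContinuousAt.mul (f.continuous.continuousAt.comp hσc) ?_
  refine ContinuousAt.comp (g := g) (f := fun γ => (σ a γ)⁻¹ * γ) g.continuous.continuousAt ?_
  have hpair : ContinuousAt (fun γ => ((σ a γ)⁻¹, γ)) γ₀ :=
    ((IsTopologicalGroupoid.continuous_inv.continuousAt).comp hσc).prodMk continuousAt_id
  have hcomp : ∀ᶠ γ in 𝓝 γ₀, ((σ a γ)⁻¹, γ) ∈ {p : Arr X × Arr X | d p.1 = r p.2} := by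
    filter_upwards [hN2] with γ h2
    exact (hσr (h2 a ha)).1
  have hmem := hcomp.self_of_nhds
  exact (IsTopologicalGroupoid.continuousOn_mul _ hmem).tendsto.comp
    (tendsto_nhdsWithin_iff.2 ⟨hpair, hcomp⟩)

namespace ConvAlg

variable [IsEtaleGroupoid X] [T2Space (Arr X)]

/-- The convolution product on `C_c(𝒢)`. -/
noncomputable instance : Mul (ConvAlg X) :=
  ⟨fun f g => ⟨⟨conv f g, continuous_conv f g⟩, hasCompactSupport_conv f g⟩⟩

theorem mul_apply (f g : ConvAlg X) (γ : Arr X) : (f * g) γ = conv f g γ := rfl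

theorem mul_apply_eq_sum (f g : ConvAlg X) (γ : Arr X) (S : Finset (Arr X))
    (hS : ∀ a ∈ S, r a = r γ) (h : ∀ a, r a = r γ → f a ≠ 0 → a ∈ S) :
    (f * g) γ = ∑ a ∈ S, f a * g (a⁻¹ * γ) :=
  conv_eq_sum S hS fun a ha hne => h a ha (left_ne_zero_of_mul hne)

theorem mul_apply_eq_sum' (f g : ConvAlg X) (γ : Arr X) (S : Finset (Arr X))
    (hS : ∀ a ∈ S, r a = r γ) (h : ∀ a, r a = r γ → g (a⁻¹ * γ) ≠ 0 → a ∈ S) :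
    (f * g) γ = ∑ a ∈ S, f a * g (a⁻¹ * γ) :=
  conv_eq_sum S hS fun a ha hne => h a ha (right_ne_zero_of_mul hne)

theorem finite_left (f : ConvAlg X) (γ : Arr X) :
    ∃ S : Finset (Arr X), (∀ a ∈ S, r a = r γ) ∧ ∀ a, r a = r γ → f a ≠ 0 → a ∈ S :=
  ⟨(finite_support_fibre f γ).toFinset, by simp, by simp; tauto⟩

theorem finite_right (g : ConvAlg X) (γ : Arr X) :
    ∃ S : Finset (Arr X), (∀ a ∈ S, r a = r γ) ∧ ∀ a, r a = r γ → g (a⁻¹ * γ) ≠ 0 → a ∈ S := by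
  classical
  have hK := hasCompactSupport g |>.isCompact.image (IsTopologicalGroupoid.continuous_inv (X := X))
  have hfin := (finite_fibre hK γ⁻¹).image fun b => γ * b
  have h : {a | r a = r γ ∧ g (a⁻¹ * γ) ≠ 0}.Finite := by
    refine hfin.subset fun a ha => ?_
    have hc : d a⁻¹ = r γ := ha.1
    refine ⟨(a⁻¹ * γ)⁻¹, ⟨⟨_, subset_tsupport _ ha.2, rfl⟩, ?_⟩, ?_⟩
    · rw [r_inv, d_mul hc, r_inv]
    · simp only
      rw [mul_inv_rev' hc, inv_inv', mul_inv_cancel_left' ha.1.symm]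
  exact ⟨h.toFinset, fun a ha => (h.mem_toFinset.1 ha).1, fun a h1 h2 => h.mem_toFinset.2 ⟨h1, h2⟩⟩

protected theorem add_mul (f g h : ConvAlg X) : (f + g) * h = f * h + g * h := by
  ext γ
  obtain ⟨S, hS, hh⟩ := finite_right h γ
  rw [add_apply, mul_apply_eq_sum' _ _ _ S hS hh, mul_apply_eq_sum' _ _ _ S hS hh,
    mul_apply_eq_sum' _ _ _ S hS hh, ← Finset.sum_add_distrib]
  simp only [add_apply, add_mul]

protected theorem mul_add (f g h : ConvAlg X) : f * (g + h) = f * g + f * h := by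
  ext γ
  obtain ⟨S, hS, hh⟩ := finite_left f γ
  rw [add_apply, mul_apply_eq_sum _ _ _ S hS hh, mul_apply_eq_sum _ _ _ S hS hh,
    mul_apply_eq_sum _ _ _ S hS hh, ← Finset.sum_add_distrib]
  simp only [add_apply, mul_add]

protected theorem smul_mul (c : ℂ) (f g : ConvAlg X) : (c • f) * g = c • (f * g) := by
  ext γ
  obtain ⟨S, hS, hh⟩ := finite_right g γ
  rw [smul_apply, mul_apply_eq_sum' _ _ _ S hS hh, mul_apply_eq_sum' _ _ _ S hS hh,
    Finset.mul_sum]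
  simp only [smul_apply, mul_assoc]

protected theorem mul_smul (c : ℂ) (f g : ConvAlg X) : f * (c • g) = c • (f * g) := by
  ext γ
  obtain ⟨S, hS, hh⟩ := finite_left f γ
  rw [smul_apply, mul_apply_eq_sum _ _ _ S hS hh, mul_apply_eq_sum _ _ _ S hS hh,
    Finset.mul_sum]
  simp only [smul_apply, mul_left_comm]

protected theorem mul_assoc (f g h : ConvAlg X) : f * g * h = f * (g * h) := by
  classical
  ext γ
  obtain ⟨S, hS, hf⟩ := finite_left f γ
  obtain ⟨T, hT, hh⟩ := finite_right h γ
  rw [mul_apply_eq_sum' _ _ _ T hT hh, mul_apply_eq_sum _ _ _ S hS hf]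
  have h1 : ∀ a ∈ T, (f * g) a * h (a⁻¹ * γ) = ∑ b ∈ S, f b * (g (b⁻¹ * a) * h (a⁻¹ * γ)) := by
    intro a ha
    rw [mul_apply_eq_sum f g a S (fun b hb => (hS b hb).trans (hT a ha).symm)
      (fun b hb hne => hf b (hb.trans (hT a ha)) hne), Finset.sum_mul]
    simp only [mul_assoc]
  rw [Finset.sum_congr rfl h1, Finset.sum_comm]
  refine Finset.sum_congr rfl fun b hb => ?_
  rw [← Finset.mul_sum]
  congr 1
  have hbγ : d b⁻¹ = r γ := hS b hb
  have hba : ∀ a ∈ T, d b⁻¹ = r a := fun a ha => (hS b hb).trans (hT a ha).symm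
  have hinj : Set.InjOn (fun a => b⁻¹ * a) T := by
    intro a ha a' ha' haa
    have haa' : b⁻¹ * a = b⁻¹ * a' := haa
    rw [← mul_inv_cancel_left' (a := b) (b := a) (hba a ha), haa', mul_inv_cancel_left' (hba a' ha')]
  rw [mul_apply_eq_sum' g h (b⁻¹ * γ) (T.image fun a => b⁻¹ * a), Finset.sum_image hinj]
  · refine Finset.sum_congr rfl fun a ha => ?_
    have hac : d a⁻¹ = r b := (hT a ha).trans (hS b hb).symm
    rw [mul_inv_rev' (hba a ha), inv_inv', mul_assoc' hac
      (show d b = r (b⁻¹ * γ) by rw [r_mul hbγ, r_inv]), mul_inv_cancel_left' (hS b hb)]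
  · intro c hc
    obtain ⟨a, ha, rfl⟩ := Finset.mem_image.1 hc
    rw [r_mul (hba a ha), r_mul hbγ]
  · intro c hc hne
    have hbc : d b = r c := by rw [hc, r_mul hbγ, r_inv]
    refine Finset.mem_image.2 ⟨b * c, hh _ ?_ ?_, inv_mul_cancel_left' hbc⟩
    · rw [r_mul hbc]; exact hS b hb
    · rw [mul_inv_rev' hbc, mul_assoc' (by rw [d_inv, r_inv, hbc]) hbγ]
      exact hne

noncomputable instance : NonUnitalRing (ConvAlg X) :=
  { (inferInstance : AddCommGroup (ConvAlg X)), (inferInstance : Mul (ConvAlg X)) with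
    left_distrib := ConvAlg.mul_add
    right_distrib := ConvAlg.add_mul
    zero_mul := fun f => by
      have h := ConvAlg.add_mul 0 0 f
      rw [add_zero] at h
      exact left_eq_add.1 h
    mul_zero := fun f => by
      have h := ConvAlg.mul_add f 0 0
      rw [add_zero] at h
      exact left_eq_add.1 h
    mul_assoc := ConvAlg.mul_assoc }

instance : IsScalarTower ℂ (ConvAlg X) (ConvAlg X) := ⟨ConvAlg.smul_mul⟩
instance : SMulCommClass ℂ (ConvAlg X) (ConvAlg X) := ⟨fun c f g => (ConvAlg.mul_smul c f g).symm⟩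

end ConvAlg

end Convolution

end AmpleGroupoid

/-!
Open invariant sets of units govern the ideals of `C_c(𝒢)`. To an ideal `I` corresponds the union
of the compact open sets `V` of units with `1_V ∈ I`. It is open, and it is invariant because
`1_B * 1_V * 1_{B⁻¹} = 1_{r(B)}` for a compact open bisection `B` with source in `V`. If it is the
whole unit space, then `I` contains local units for all of `C_c(𝒢)`. If `𝒢` is effective and `I` is
nonzero, it is nonempty: some `f ∈ I` is nonzero at a unit, and effectiveness provides a small `V`
around which `1_V * f * 1_V` is supported on units and invertible there, so that `1_V ∈ I`.

Conversely, the functions supported over an invariant set of units form an ideal, whence minimality.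
Simplicity also makes the augmentation representation on functions on the unit space faithful; but
this representation does not distinguish `1_B` from `1_{r(B)}` when the bisection `B` lies in the
isotropy, so such a `B` consists of units.
-/

namespace AmpleGroupoid

open CategoryTheory Set Topology TopologicalSpace
open scoped Pointwise

universe v u

/-! ### Arrows and bisections -/

section Arrows

variable {X : Type u} [Groupoid.{v} X]

instance : InvolutiveInv (Arr X) := ⟨inv_inv'⟩

theorem mem_unitSpace_iff {g : Arr X} : g ∈ unitSpace X ↔ r g = g :=
  ⟨by rintro ⟨a, rfl⟩; rfl, fun h => ⟨g, h⟩⟩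

theorem d_eq_self {g : Arr X} (hg : g ∈ unitSpace X) : d g = g := by
  obtain ⟨a, rfl⟩ := hg
  rfl

theorem unitSpace_subset_iso : unitSpace X ⊆ iso X := by
  rintro _ ⟨a, rfl⟩
  rfl

theorem image_r_subset_unitSpace (B : Set (Arr X)) : r '' B ⊆ unitSpace X :=
  image_subset_range _ _

theorem injOn_r_unitSpace : InjOn r (unitSpace X) := fun a ha b hb h => by
  rwa [mem_unitSpace_iff.1 ha, mem_unitSpace_iff.1 hb] at h

theorem mul_d (g : Arr X) : g * d g = g := by
  obtain ⟨x, y, p⟩ := g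
  simp [d, mul_mk]

theorem r_mul_self (g : Arr X) : r g * g = g := by
  obtain ⟨x, y, p⟩ := g
  simp [r, mul_mk]

theorem inv_r (g : Arr X) : (r g)⁻¹ = r g := by
  obtain ⟨x, y, p⟩ := g
  simp [r, inv_mk]

theorem r_inv_mul {a b : Arr X} (h : r a = r b) : r (a⁻¹ * b) = d a := by
  rw [r_mul (by rwa [d_inv]), r_inv]

theorem d_inv_mul {a b : Arr X} (h : r a = r b) : d (a⁻¹ * b) = d b :=
  d_mul (by rwa [d_inv])

theorem inv_mul_r {a b : Arr X} (h : r a = r b) : a⁻¹ * r b = a⁻¹ := by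
  rw [← h, ← d_inv, mul_d]

theorem eq_of_inv_mul_mem_unitSpace {a b : Arr X} (h : r a = r b)
    (hu : a⁻¹ * b ∈ unitSpace X) : a = b := by
  have hd : a⁻¹ * b = d a := by rw [← r_inv_mul h, mem_unitSpace_iff.1 hu]
  rw [← mul_inv_cancel_left' h, hd, mul_d]

theorem bijOn_inv_mul (a : Arr X) :
    BijOn (fun b => a⁻¹ * b) {b | r b = r a} {c | r c = d a} := by
  refine BijOn.mk (fun b hb => r_inv_mul (Eq.symm hb)) (fun b hb c hc h => ?_) fun c hc => ?_
  · rw [← mul_inv_cancel_left' (Eq.symm hb), ← mul_inv_cancel_left' (Eq.symm hc)]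
    exact congrArg (a * ·) h
  · exact ⟨a * c, r_mul (Eq.symm hc), inv_mul_cancel_left' (Eq.symm hc)⟩

/-- A bisection: a set of arrows on which both the range and the source map are injective.
No topological condition is included. -/
structure IsBisection (B : Set (Arr X)) : Prop where
  injOn_r : InjOn r B
  injOn_d : InjOn d B

theorem IsBisection.mono {B C : Set (Arr X)} (hC : IsBisection C) (h : B ⊆ C) : IsBisection B :=
  ⟨hC.injOn_r.mono h, hC.injOn_d.mono h⟩

end Arrows

/-! ### Convolution of arbitrary functions -/

section Convolution

variable {X : Type u} [Groupoid.{v} X]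

theorem conv_eq_zero {f g : Arr X → ℂ} {γ : Arr X}
    (h : ∀ a, r a = r γ → f a * g (a⁻¹ * γ) = 0) : conv f g γ = 0 :=
  finsum_mem_of_eqOn_zero h

theorem conv_eq_single {f g : Arr X → ℂ} {γ a : Arr X} (ha : r a = r γ)
    (h : ∀ b, r b = r γ → f b ≠ 0 → g (b⁻¹ * γ) ≠ 0 → b = a) :
    conv f g γ = f a * g (a⁻¹ * γ) := by
  rw [conv_eq_sum {a} (by simpa using ha) fun b hb hne => Finset.mem_singleton.2
    (h b hb (left_ne_zero_of_mul hne) (right_ne_zero_of_mul hne)), Finset.sum_singleton]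

theorem conv_of_support_left_subset_unitSpace {f : Arr X → ℂ}
    (hf : Function.support f ⊆ unitSpace X) (g : Arr X → ℂ) (γ : Arr X) :
    conv f g γ = f (r γ) * g γ := by
  rw [conv_eq_single (r_r γ) fun b hb hne _ => by rw [← hb, mem_unitSpace_iff.1 (hf hne)],
    inv_r, r_mul_self]

theorem conv_of_support_right_subset_unitSpace {g : Arr X → ℂ}
    (hg : Function.support g ⊆ unitSpace X) (f : Arr X → ℂ) (γ : Arr X) :
    conv f g γ = f γ * g (d γ) := by
  rw [conv_eq_single rfl fun b hb _ hne => eq_of_inv_mul_mem_unitSpace hb (hg hne), ← d_eq]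

theorem conv_indicator_inv_apply_r {B : Set (Arr X)} (hB : InjOn r B) (f : Arr X → ℂ)
    {b : Arr X} (hb : b ∈ B) : conv f (B⁻¹.indicator 1) (r b) = f b := by
  rw [conv_eq_single (a := b) (r_r b).symm, inv_mul_r rfl, indicator_of_mem (inv_mem_inv.2 hb),
    Pi.one_apply, mul_one]
  intro c hc _ hne
  rw [inv_mul_r (b := b) hc] at hne
  exact hB (inv_mem_inv.1 (mem_of_indicator_ne_zero hne)) hb hc

theorem conv_indicator_indicator_inv {B : Set (Arr X)} (hB : IsBisection B) :
    conv (B.indicator 1) (B⁻¹.indicator 1) = (r '' B).indicator 1 := by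
  ext γ
  by_cases hγ : γ ∈ r '' B
  · obtain ⟨b, hb, rfl⟩ := hγ
    rw [conv_indicator_inv_apply_r hB.injOn_r _ hb, indicator_of_mem hb,
      indicator_of_mem (mem_image_of_mem r hb), Pi.one_apply, Pi.one_apply]
  · rw [indicator_of_notMem hγ]
    refine conv_eq_zero fun b hb => ?_
    by_contra hne
    have hbB : b ∈ B := mem_of_indicator_ne_zero (left_ne_zero_of_mul hne)
    have hinvB : (b⁻¹ * γ)⁻¹ ∈ B :=
      mem_inv.1 (mem_of_indicator_ne_zero (right_ne_zero_of_mul hne))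
    have hinv : (b⁻¹ * γ)⁻¹ = b := hB.injOn_d hinvB hbB (by rw [d_inv, r_inv_mul hb])
    refine hγ ⟨b, hbB, ?_⟩
    calc r b = b * b⁻¹ := r_eq b
      _ = b * (b⁻¹ * γ) := by rw [inv_eq_iff_eq_inv.1 hinv]
      _ = γ := mul_inv_cancel_left' hb

end Convolution

/-! ### Compact open sets of arrows -/

section CompactOpens

theorem exists_compactOpens_subset_of_isLocalHomeomorph {Y Z : Type*} [TopologicalSpace Y]
    [TopologicalSpace Z] {f : Y → Z} (hf : IsLocalHomeomorph f)
    (hZ : IsTopologicalBasis {U : Set Z | IsCompact U ∧ IsOpen U}) {O : Set Y} (hO : IsOpen O)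
    {y : Y} (hy : y ∈ O) : ∃ B : CompactOpens Y, y ∈ B ∧ (B : Set Y) ⊆ O := by
  obtain ⟨e, he, -⟩ := hf y
  obtain ⟨V, ⟨hVc, hVo⟩, hyV, hVO⟩ := hZ.exists_subset_of_mem_open
    (mem_image_of_mem e (show y ∈ e.source ∩ O from ⟨he, hy⟩))
    (e.isOpen_image_of_subset_source (e.open_source.inter hO) inter_subset_left)
  have hVt : V ⊆ e.target := hVO.trans (e.image_source_eq_target ▸ image_mono inter_subset_left)
  refine ⟨⟨⟨e.symm '' V, hVc.image_of_continuousOn (e.symm.continuousOn.mono hVt)⟩,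
    e.symm.isOpen_image_of_subset_source hVo hVt⟩, ⟨e y, hyV, e.left_inv he⟩, ?_⟩
  rintro _ ⟨v, hv, rfl⟩
  obtain ⟨a, ⟨ha, haO⟩, rfl⟩ := hVO hv
  rwa [e.left_inv ha]

variable {X : Type u} [Groupoid.{v} X] [TopologicalSpace (Arr X)]

instance [IsTopologicalGroupoid X] : ContinuousInv (Arr X) :=
  ⟨IsTopologicalGroupoid.continuous_inv⟩

theorem exists_isOpen_injOn_r [IsEtaleGroupoid X] (g : Arr X) :
    ∃ O, IsOpen O ∧ g ∈ O ∧ InjOn r O := by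
  obtain ⟨O, hO, hgO, hinj⟩ :=
    (IsEtaleGroupoid.isLocalHomeomorph_rMap (X := X)).isLocallyInjective g
  exact ⟨O, hO, hgO, fun a ha b hb h => hinj ha hb (rMap_eq_iff.2 h)⟩

theorem exists_isOpen_isBisection [IsEtaleGroupoid X] (g : Arr X) :
    ∃ O, IsOpen O ∧ g ∈ O ∧ IsBisection O := by
  obtain ⟨O, hO, hgO, hOinj⟩ := exists_isOpen_injOn_r g
  obtain ⟨P, hP, hgP, hPinj⟩ := exists_isOpen_injOn_r g⁻¹
  exact ⟨O ∩ P⁻¹, hO.inter hP.inv, ⟨hgO, hgP⟩, hOinj.mono inter_subset_left,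
    fun a ha b hb h => inv_injective (hPinj ha.2 hb.2 h)⟩

theorem isOpen_unitSpace [IsEtaleGroupoid X] : IsOpen (unitSpace X) := by
  refine isOpen_iff_mem_nhds.2 fun u hu => ?_
  obtain ⟨O, hO, huO, hinj⟩ := exists_isOpen_injOn_r u
  have hOr : IsOpen (O ∩ r ⁻¹' O) := hO.inter (hO.preimage continuous_r)
  refine Filter.mem_of_superset (hOr.mem_nhds ⟨huO, ?_⟩) ?_
  · rwa [mem_preimage, mem_unitSpace_iff.1 hu]
  · rintro g ⟨hg, hrg⟩
    exact mem_unitSpace_iff.2 (hinj hrg hg (r_r g))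

theorem isClosed_unitSpace [IsTopologicalGroupoid X] [T2Space (Arr X)] :
    IsClosed (unitSpace X) := by
  have h : unitSpace X = {g | r g = g} := ext fun _ => mem_unitSpace_iff
  rw [h]
  exact isClosed_eq continuous_r continuous_id

theorem isOpenMap_r [IsEtaleGroupoid X] : IsOpenMap (r : Arr X → Arr X) :=
  isOpen_unitSpace.isOpenMap_subtype_val.comp
    (IsEtaleGroupoid.isLocalHomeomorph_rMap (X := X)).isOpenMap

theorem exists_compactOpens_subset [IsAmpleGroupoid X] {O : Set (Arr X)} (hO : IsOpen O)
    {g : Arr X} (hg : g ∈ O) : ∃ B : CompactOpens (Arr X), g ∈ B ∧ (B : Set (Arr X)) ⊆ O :=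
  exists_compactOpens_subset_of_isLocalHomeomorph IsEtaleGroupoid.isLocalHomeomorph_rMap
    IsAmpleGroupoid.isTopologicalBasis_compactOpen hO hg

theorem exists_compactOpens_isBisection_subset [IsAmpleGroupoid X] {O : Set (Arr X)}
    (hO : IsOpen O) {g : Arr X} (hg : g ∈ O) :
    ∃ B : CompactOpens (Arr X), IsBisection (B : Set (Arr X)) ∧ g ∈ B ∧ (B : Set (Arr X)) ⊆ O := by
  obtain ⟨P, hP, hgP, hbis⟩ := exists_isOpen_isBisection g
  obtain ⟨B, hgB, hB⟩ := exists_compactOpens_subset (hP.inter hO) ⟨hgP, hg⟩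
  exact ⟨B, hbis.mono (hB.trans inter_subset_left), hgB, hB.trans inter_subset_right⟩

end CompactOpens

/-! ### Characteristic functions -/

section CharFn

variable {X : Type u} [Groupoid.{v} X] [TopologicalSpace (Arr X)]

theorem ConvAlg.sub_apply (f g : ConvAlg X) (γ : Arr X) : (f - g) γ = f γ - g γ := rfl

variable [T2Space (Arr X)]

/-- The extension by zero of a function that is continuous on a compact open set of arrows. -/
noncomputable def extendByZero (B : CompactOpens (Arr X)) {φ : Arr X → ℂ}
    (hφ : ContinuousOn φ B) : ConvAlg X :=
  ⟨⟨(B : Set (Arr X)).indicator φ, by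
    have hB : IsClopen (B : Set (Arr X)) := ⟨B.isCompact.isClosed, B.isOpen⟩
    refine continuous_indicator (fun a ha => ?_) (by rwa [hB.isClosed.closure_eq])
    rw [hB.frontier_eq] at ha
    exact absurd ha (notMem_empty a)⟩,
    HasCompactSupport.of_support_subset_isCompact B.isCompact support_indicator_subset⟩

/-- The characteristic function of a compact open set of arrows. -/
noncomputable def charFn (B : CompactOpens (Arr X)) : ConvAlg X :=
  extendByZero B (φ := 1) continuousOn_const

theorem coe_charFn (B : CompactOpens (Arr X)) :
    ⇑(charFn B) = (B : Set (Arr X)).indicator 1 := rfl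

theorem charFn_apply_of_mem {B : CompactOpens (Arr X)} {g : Arr X} (hg : g ∈ B) :
    charFn B g = 1 :=
  indicator_of_mem (SetLike.mem_coe.2 hg) _

theorem charFn_apply_of_notMem {B : CompactOpens (Arr X)} {g : Arr X} (hg : g ∉ B) :
    charFn B g = 0 :=
  indicator_of_notMem (fun h => hg (SetLike.mem_coe.1 h)) _

theorem charFn_apply_ne_zero_iff {B : CompactOpens (Arr X)} {g : Arr X} :
    charFn B g ≠ 0 ↔ g ∈ B :=
  ⟨fun h => by_contra fun hg => h (charFn_apply_of_notMem hg),
    fun hg => charFn_apply_of_mem hg ▸ one_ne_zero⟩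

theorem charFn_injective : Function.Injective (charFn (X := X)) := fun B C h =>
  SetLike.ext fun g => by rw [← charFn_apply_ne_zero_iff, h, charFn_apply_ne_zero_iff]

theorem charFn_bot : charFn (⊥ : CompactOpens (Arr X)) = 0 :=
  ConvAlg.ext fun γ => charFn_apply_of_notMem (notMem_empty γ)

theorem charFn_ne_zero {B : CompactOpens (Arr X)} {g : Arr X} (hg : g ∈ B) : charFn B ≠ 0 :=
  fun h => charFn_apply_ne_zero_iff.2 hg (by rw [h, ConvAlg.zero_apply])

instance [IsAmpleGroupoid X] [Nonempty X] : Nontrivial (ConvAlg X) := by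
  obtain ⟨x⟩ := ‹Nonempty X›
  obtain ⟨B, hxB, -⟩ := exists_compactOpens_subset isOpen_univ (mem_univ (⟨x, x, 𝟙 x⟩ : Arr X))
  exact nontrivial_of_ne _ 0 (charFn_ne_zero hxB)

variable [IsEtaleGroupoid X]

theorem extendByZero_mul_apply {V : CompactOpens (Arr X)} {φ : Arr X → ℂ} (hφ : ContinuousOn φ V)
    (hV : (V : Set (Arr X)) ⊆ unitSpace X) (g : ConvAlg X) (γ : Arr X) :
    (extendByZero V hφ * g) γ = (V : Set (Arr X)).indicator φ (r γ) * g γ :=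
  conv_of_support_left_subset_unitSpace (support_indicator_subset.trans hV) _ _

theorem mul_extendByZero_apply {V : CompactOpens (Arr X)} {φ : Arr X → ℂ} (hφ : ContinuousOn φ V)
    (hV : (V : Set (Arr X)) ⊆ unitSpace X) (g : ConvAlg X) (γ : Arr X) :
    (g * extendByZero V hφ) γ = g γ * (V : Set (Arr X)).indicator φ (d γ) :=
  conv_of_support_right_subset_unitSpace (support_indicator_subset.trans hV) _ _

theorem charFn_mul_apply {V : CompactOpens (Arr X)} (hV : (V : Set (Arr X)) ⊆ unitSpace X)
    (g : ConvAlg X) (γ : Arr X) : (charFn V * g) γ = charFn V (r γ) * g γ :=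
  extendByZero_mul_apply _ hV g γ

theorem mul_charFn_apply {V : CompactOpens (Arr X)} (hV : (V : Set (Arr X)) ⊆ unitSpace X)
    (g : ConvAlg X) (γ : Arr X) : (g * charFn V) γ = g γ * charFn V (d γ) :=
  mul_extendByZero_apply _ hV g γ

theorem charFn_mul_eq_self {V : CompactOpens (Arr X)} (hV : (V : Set (Arr X)) ⊆ unitSpace X)
    {g : ConvAlg X} (hg : ∀ γ, g γ ≠ 0 → r γ ∈ V) : charFn V * g = g := by
  ext γ
  rw [charFn_mul_apply hV]
  by_cases hγ : g γ = 0
  · rw [hγ, mul_zero]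
  · rw [charFn_apply_of_mem (hg γ hγ), one_mul]

theorem mul_charFn_eq_self {V : CompactOpens (Arr X)} (hV : (V : Set (Arr X)) ⊆ unitSpace X)
    {g : ConvAlg X} (hg : ∀ γ, g γ ≠ 0 → d γ ∈ V) : g * charFn V = g := by
  ext γ
  rw [mul_charFn_apply hV]
  by_cases hγ : g γ = 0
  · rw [hγ, zero_mul]
  · rw [charFn_apply_of_mem (hg γ hγ), mul_one]

theorem charFn_sup {U V : CompactOpens (Arr X)} (hU : (U : Set (Arr X)) ⊆ unitSpace X)
    (hV : (V : Set (Arr X)) ⊆ unitSpace X) :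
    charFn (U ⊔ V) = charFn U + (charFn V - charFn U * charFn V) := by
  ext γ
  rw [ConvAlg.add_apply, ConvAlg.sub_apply, charFn_mul_apply hU]
  by_cases hγV : γ ∈ V
  · rw [charFn_apply_of_mem (B := U ⊔ V) (Or.inr hγV), mem_unitSpace_iff.1 (hV hγV),
      charFn_apply_of_mem hγV]
    ring
  · rw [charFn_apply_of_notMem hγV, mul_zero, sub_zero, add_zero, coe_charFn, coe_charFn]
    exact indicator_eq_indicator (or_iff_left hγV) rfl

theorem charFn_mul_charFn_map_inv {B : CompactOpens (Arr X)}
    (hB : IsBisection (B : Set (Arr X))) :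
    charFn B * charFn (B.map Inv.inv continuous_inv (Homeomorph.inv _).isOpenMap) =
      charFn (B.map r continuous_r isOpenMap_r) := by
  refine DFunLike.coe_injective ((?_ : _ = conv _ _).trans (conv_indicator_indicator_inv hB))
  rw [← image_inv_eq_inv]
  rfl

end CharFn

/-! ### Effective groupoids -/

section Effective

variable {X : Type u} [Groupoid.{v} X] [TopologicalSpace (Arr X)]

theorem IsEffective.exists_d_ne_r (he : IsEffective X) {O : Set (Arr X)} (hO : IsOpen O)
    (hne : O.Nonempty) (hOu : Disjoint O (unitSpace X)) : ∃ g ∈ O, d g ≠ r g := by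
  by_contra! hiso
  obtain ⟨g, hg⟩ := hne
  have hgu : g ∈ unitSpace X := by
    rw [show unitSpace X = interior (iso X) from he]
    exact interior_maximal hiso hO hg
  exact disjoint_left.1 hOu hg hgu

variable [IsEtaleGroupoid X] [T2Space (Arr X)]

theorem IsEffective.exists_subset_forall_d_notMem_of_injOn (he : IsEffective X)
    {B : Set (Arr X)} (hB : IsOpen B) (hinj : InjOn r B) (hBu : Disjoint B (unitSpace X))
    {V : Set (Arr X)} (hV : IsOpen V) (hne : V.Nonempty) :
    ∃ W ⊆ V, IsOpen W ∧ W.Nonempty ∧ ∀ γ ∈ B, r γ ∈ W → d γ ∉ W := by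
  rcases (B ∩ (r ⁻¹' V ∩ d ⁻¹' V)).eq_empty_or_nonempty with hempty | hO
  · exact ⟨V, Subset.rfl, hV, hne, fun γ hγ hr hd => hempty.subset ⟨hγ, hr, hd⟩⟩
  obtain ⟨g, ⟨hgB, hgr, -⟩, hdr⟩ := he.exists_d_ne_r
    (hB.inter ((hV.preimage continuous_r).inter (hV.preimage continuous_d))) hO
    (hBu.mono_left inter_subset_left)
  obtain ⟨P, Q, hP, hQ, hgP, hgQ, hPQ⟩ := t2_separation hdr.symm
  refine ⟨V ∩ (P ∩ r '' (B ∩ d ⁻¹' Q)), inter_subset_left,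
    hV.inter (hP.inter (isOpenMap_r _ (hB.inter (hQ.preimage continuous_d)))),
    ⟨r g, hgr, hgP, mem_image_of_mem r ⟨hgB, hgQ⟩⟩, ?_⟩
  rintro γ hγ ⟨-, -, b, ⟨hb, hbQ⟩, hbγ⟩ ⟨-, hdP, -⟩
  obtain rfl := hinj hb hγ hbγ
  exact disjoint_left.1 hPQ hdP hbQ

theorem IsEffective.exists_subset_forall_d_notMem (he : IsEffective X) {K : Set (Arr X)}
    (hK : IsCompact K) (hKu : Disjoint K (unitSpace X)) {V : Set (Arr X)} (hV : IsOpen V)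
    (hne : V.Nonempty) : ∃ W ⊆ V, IsOpen W ∧ W.Nonempty ∧ ∀ γ ∈ K, r γ ∈ W → d γ ∉ W := by
  revert V
  refine hK.induction_on (p := fun s => ∀ {V : Set (Arr X)}, IsOpen V → V.Nonempty →
    ∃ W ⊆ V, IsOpen W ∧ W.Nonempty ∧ ∀ γ ∈ s, r γ ∈ W → d γ ∉ W) ?_ ?_ ?_ ?_
  · exact fun {V} hV hne => ⟨V, Subset.rfl, hV, hne, fun γ hγ => absurd hγ (notMem_empty γ)⟩
  · intro s t hst ht V hV hne
    obtain ⟨W, hWV, hW, hWne, hd⟩ := ht hV hne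
    exact ⟨W, hWV, hW, hWne, fun γ hγ => hd γ (hst hγ)⟩
  · intro s t hs ht V hV hne
    obtain ⟨W, hWV, hW, hWne, hsd⟩ := hs hV hne
    obtain ⟨W', hWW', hW', hWne', htd⟩ := ht hW hWne
    refine ⟨W', hWW'.trans hWV, hW', hWne', fun γ hγ hr hd => hγ.elim (fun hγs => ?_)
      fun hγt => htd γ hγt hr hd⟩
    exact hsd γ hγs (hWW' hr) (hWW' hd)
  · intro g hg
    obtain ⟨O, hO, hgO, hinj⟩ := exists_isOpen_injOn_r g
    have hOu : IsOpen (O \ unitSpace X) := hO.sdiff isClosed_unitSpace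
    exact ⟨O \ unitSpace X,
      mem_nhdsWithin_of_mem_nhds (hOu.mem_nhds ⟨hgO, disjoint_left.1 hKu hg⟩), fun hV hne =>
        he.exists_subset_forall_d_notMem_of_injOn hOu (hinj.mono sdiff_subset) disjoint_sdiff_left
          hV hne⟩

end Effective

/-! ### Ideals and open invariant sets of units -/

section Ideals

variable {X : Type u} [Groupoid.{v} X] [TopologicalSpace (Arr X)] [T2Space (Arr X)]
  [IsEtaleGroupoid X]

/-- The compact open sets of units whose characteristic function lies in the ideal `I`. -/
def unitCompactOpens (I : TwoSidedIdeal (ConvAlg X)) : Set (CompactOpens (Arr X)) :=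
  {V | (V : Set (Arr X)) ⊆ unitSpace X ∧ charFn V ∈ I}

theorem bot_mem_unitCompactOpens (I : TwoSidedIdeal (ConvAlg X)) : ⊥ ∈ unitCompactOpens I :=
  ⟨empty_subset _, charFn_bot (X := X) ▸ I.zero_mem⟩

theorem sup_mem_unitCompactOpens {I : TwoSidedIdeal (ConvAlg X)} {U V : CompactOpens (Arr X)}
    (hU : U ∈ unitCompactOpens I) (hV : V ∈ unitCompactOpens I) : U ⊔ V ∈ unitCompactOpens I :=
  ⟨union_subset hU.1 hV.1, charFn_sup hU.1 hV.1 ▸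
    I.add_mem hU.2 (I.sub_mem hV.2 (I.mul_mem_right _ _ hU.2))⟩

theorem exists_mem_unitCompactOpens_superset {I : TwoSidedIdeal (ConvAlg X)} {K : Set (Arr X)}
    (hK : IsCompact K) (h : ∀ u ∈ K, ∃ V ∈ unitCompactOpens I, u ∈ V) :
    ∃ V ∈ unitCompactOpens I, K ⊆ V := by
  refine hK.induction_on (p := fun s => ∃ V ∈ unitCompactOpens I, s ⊆ V)
    ⟨⊥, bot_mem_unitCompactOpens I, empty_subset _⟩
    (fun s t hst ⟨V, hV, htV⟩ => ⟨V, hV, hst.trans htV⟩)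
    (fun s t ⟨U, hU, hsU⟩ ⟨V, hV, htV⟩ =>
      ⟨U ⊔ V, sup_mem_unitCompactOpens hU hV, union_subset_union hsU htV⟩) fun u hu => ?_
  obtain ⟨V, hV, huV⟩ := h u hu
  exact ⟨V, mem_nhdsWithin_of_mem_nhds (V.isOpen.mem_nhds huV), V, hV, Subset.rfl⟩

theorem mem_unitCompactOpens_of_forall_mem_unitSpace {I : TwoSidedIdeal (ConvAlg X)}
    {f : ConvAlg X} (hf : f ∈ I) {V : CompactOpens (Arr X)}
    (hV : (V : Set (Arr X)) ⊆ unitSpace X) (hfV : ∀ v ∈ V, f v ≠ 0)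
    (h : ∀ γ, f γ ≠ 0 → r γ ∈ V → d γ ∈ V → γ ∈ unitSpace X) : V ∈ unitCompactOpens I := by
  have hφ : ContinuousOn (fun γ => (f γ)⁻¹) V := f.continuous.continuousOn.inv₀ hfV
  have hfac : charFn V = charFn V * f * extendByZero V hφ := by
    ext γ
    rw [mul_extendByZero_apply hφ hV, charFn_mul_apply hV]
    by_cases hγ : γ ∈ V
    · rw [mem_unitSpace_iff.1 (hV hγ), d_eq_self (hV hγ), charFn_apply_of_mem hγ, one_mul,
        indicator_of_mem (SetLike.mem_coe.2 hγ), mul_inv_cancel₀ (hfV γ hγ)]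
    · rw [charFn_apply_of_notMem hγ]
      by_contra hne
      obtain ⟨hrf, hd⟩ := mul_ne_zero_iff.1 (Ne.symm hne)
      obtain ⟨hr, hfγ⟩ := mul_ne_zero_iff.1 hrf
      have hrV : r γ ∈ V := charFn_apply_ne_zero_iff.1 hr
      have hγu : γ ∈ unitSpace X := h γ hfγ hrV (mem_of_indicator_ne_zero hd)
      exact hγ (mem_unitSpace_iff.1 hγu ▸ hrV)
  exact ⟨hV, hfac ▸ I.mul_mem_right _ _ (I.mul_mem_left _ _ hf)⟩

/-- The open set of units attached to the ideal `I`: the units with a compact open neighbourhood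
in the unit space whose characteristic function lies in `I`. -/
def unitsOfIdeal (I : TwoSidedIdeal (ConvAlg X)) : Set (unitSpace X) :=
  {u | ∃ V ∈ unitCompactOpens I, (u : Arr X) ∈ V}

theorem isOpen_unitsOfIdeal (I : TwoSidedIdeal (ConvAlg X)) : IsOpen (unitsOfIdeal I) := by
  refine isOpen_iff_mem_nhds.2 fun u ⟨V, hV, huV⟩ => ?_
  exact Filter.mem_of_superset ((V.isOpen.preimage continuous_subtype_val).mem_nhds huV)
    fun w hw => ⟨V, hV, hw⟩

theorem eq_top_of_unitsOfIdeal_eq_univ {I : TwoSidedIdeal (ConvAlg X)}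
    (hI : unitsOfIdeal I = univ) : I = ⊤ := by
  refine eq_top_iff.2 fun f _ => ?_
  obtain ⟨V, hV, hfV⟩ := exists_mem_unitCompactOpens_superset (I := I)
    (f.hasCompactSupport.isCompact.image continuous_r) <|
    forall_mem_image.2 fun γ _ => hI.symm.subset (mem_univ (rMap γ))
  rw [← charFn_mul_eq_self hV.1 fun γ hγ => hfV (mem_image_of_mem r (subset_tsupport f hγ))]
  exact I.mul_mem_right _ _ hV.2

end Ideals

section AmpleIdeals

variable {X : Type u} [Groupoid.{v} X] [TopologicalSpace (Arr X)] [T2Space (Arr X)]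
  [IsAmpleGroupoid X]

theorem rMap_mem_unitsOfIdeal {I : TwoSidedIdeal (ConvAlg X)} {g : Arr X}
    (hg : dMap g ∈ unitsOfIdeal I) : rMap g ∈ unitsOfIdeal I := by
  obtain ⟨V, hV, hgV⟩ := hg
  obtain ⟨B, hB, hgB, hBV⟩ := exists_compactOpens_isBisection_subset
    (V.isOpen.preimage continuous_d) (show g ∈ d ⁻¹' V from hgV)
  refine ⟨B.map r continuous_r isOpenMap_r, ⟨image_r_subset_unitSpace _, ?_⟩,
    mem_image_of_mem r hgB⟩
  rw [← charFn_mul_charFn_map_inv hB,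
    ← mul_charFn_eq_self hV.1 fun γ hγ => hBV (charFn_apply_ne_zero_iff.1 hγ)]
  exact I.mul_mem_right _ _ (I.mul_mem_left _ _ hV.2)

theorem isInvariant_unitsOfIdeal (I : TwoSidedIdeal (ConvAlg X)) :
    IsInvariant (unitsOfIdeal I) :=
  fun g => ⟨rMap_mem_unitsOfIdeal, rMap_mem_unitsOfIdeal (g := g⁻¹)⟩

theorem exists_mem_apply_unit_ne_zero {I : TwoSidedIdeal (ConvAlg X)} {f : ConvAlg X}
    (hf : f ∈ I) (hf0 : f ≠ 0) : ∃ f' ∈ I, ∃ u ∈ unitSpace X, f' u ≠ 0 := by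
  obtain ⟨γ, hγ⟩ := DFunLike.ne_iff.1 hf0
  obtain ⟨B, hB, hγB, -⟩ := exists_compactOpens_isBisection_subset isOpen_univ (mem_univ γ)
  let C : CompactOpens (Arr X) := B.map Inv.inv continuous_inv (Homeomorph.inv _).isOpenMap
  have hC : (C : Set (Arr X)) = (B : Set (Arr X))⁻¹ := image_inv_eq_inv
  refine ⟨f * charFn C, I.mul_mem_right _ _ hf, r γ, mem_range_self γ, ?_⟩
  rwa [ConvAlg.mul_apply, coe_charFn, hC, conv_indicator_inv_apply_r hB.injOn_r _ hγB]

theorem IsEffective.exists_nonempty_mem_unitCompactOpens (he : IsEffective X)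
    {I : TwoSidedIdeal (ConvAlg X)} {f : ConvAlg X} (hf : f ∈ I) (hf0 : f ≠ 0) :
    ∃ V ∈ unitCompactOpens I, (V : Set (Arr X)).Nonempty := by
  obtain ⟨f', hf', u, hu, hf'u⟩ := exists_mem_apply_unit_ne_zero hf hf0
  have hV : IsOpen (unitSpace X ∩ {γ | f' γ ≠ 0}) :=
    isOpen_unitSpace.inter (isOpen_ne_fun f'.continuous continuous_const)
  obtain ⟨W, hWV, hW, ⟨w, hw⟩, hd⟩ := he.exists_subset_forall_d_notMem
    (f'.hasCompactSupport.isCompact.diff isOpen_unitSpace) disjoint_sdiff_left hV ⟨u, hu, hf'u⟩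
  obtain ⟨V, hwV, hVW⟩ := exists_compactOpens_subset hW hw
  refine ⟨V, mem_unitCompactOpens_of_forall_mem_unitSpace hf' (fun v hv => (hWV (hVW hv)).1)
    (fun v hv => (hWV (hVW hv)).2) fun γ hγ hrV hdV => ?_, w, hwV⟩
  by_contra hγu
  exact hd γ ⟨subset_tsupport f' hγ, hγu⟩ (hVW hrV) (hVW hdV)

theorem isSimpleRing_of_isMinimal_of_isEffective [Nonempty X] (hm : IsMinimal X)
    (he : IsEffective X) : IsSimpleRing (ConvAlg X) := by
  refine IsSimpleRing.of_eq_bot_or_eq_top fun I => or_iff_not_imp_left.2 fun hI => ?_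
  obtain ⟨f, hf, hf0⟩ := SetLike.exists_of_lt (bot_lt_iff_ne_bot.2 hI)
  rw [TwoSidedIdeal.mem_bot] at hf0
  obtain ⟨V, hV, v, hv⟩ := he.exists_nonempty_mem_unitCompactOpens hf hf0
  have hne : (unitsOfIdeal I).Nonempty := ⟨⟨v, hV.1 hv⟩, V, hV, hv⟩
  exact eq_top_of_unitsOfIdeal_eq_univ
    ((hm _ (isOpen_unitsOfIdeal I) (isInvariant_unitsOfIdeal I)).resolve_left hne.ne_empty)

end AmpleIdeals

/-! ### The ideal of an invariant set -/

section InvariantIdeal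

variable {X : Type u} [Groupoid.{v} X] [TopologicalSpace (Arr X)] [T2Space (Arr X)]
  [IsEtaleGroupoid X]

/-- The ideal of functions that vanish on all arrows with range outside an invariant set. -/
noncomputable def idealOfInvariant (U : Set (unitSpace X)) (hU : IsInvariant U) :
    TwoSidedIdeal (ConvAlg X) :=
  TwoSidedIdeal.mk' {f | ∀ γ, rMap γ ∉ U → f γ = 0}
    (fun _ _ => rfl)
    (fun {f g} hf hg γ hγ => by rw [ConvAlg.add_apply, hf γ hγ, hg γ hγ, add_zero])
    (fun {f} hf γ hγ => by rw [show (-f) γ = -f γ from rfl, hf γ hγ, neg_zero])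
    (fun {f g} hg γ hγ => conv_eq_zero fun a ha => by
      have hr : rMap (a⁻¹ * γ) = dMap a := Subtype.ext (r_inv_mul ha)
      rw [hg _ (by rwa [hr, hU a, rMap_eq_iff.2 ha]), mul_zero])
    (fun {f g} hf γ hγ => conv_eq_zero fun a ha => by
      rw [hf a (by rwa [rMap_eq_iff.2 ha]), zero_mul])

theorem mem_idealOfInvariant {U : Set (unitSpace X)} {hU : IsInvariant U} {f : ConvAlg X} :
    f ∈ idealOfInvariant U hU ↔ ∀ γ, rMap γ ∉ U → f γ = 0 :=
  TwoSidedIdeal.mem_mk' ..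

theorem charFn_mem_idealOfInvariant_iff {U : Set (unitSpace X)} {hU : IsInvariant U}
    {V : CompactOpens (Arr X)} : charFn V ∈ idealOfInvariant U hU ↔ ∀ γ ∈ V, rMap γ ∈ U :=
  mem_idealOfInvariant.trans <| forall_congr' fun _ =>
    not_imp_comm.trans (imp_congr_left charFn_apply_ne_zero_iff)

end InvariantIdeal

/-! ### The augmentation representation -/

section Augmentation

theorem finsum_mem_sum_comm {α β M : Type*} [AddCommMonoid M] {s : Set α} (t : Finset β)
    {f : α → β → M} (h : ∀ b ∈ t, (s ∩ Function.support fun a => f a b).Finite) :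
    ∑ᶠ a ∈ s, ∑ b ∈ t, f a b = ∑ b ∈ t, ∑ᶠ a ∈ s, f a b := by
  simp only [finsum_mem_def]
  rw [← finsum_sum_comm t (fun a b => s.indicator (fun a => f a b) a) fun b hb => ?_]
  · exact finsum_congr fun a => by by_cases ha : a ∈ s <;> simp [ha]
  · have hfin := h b hb
    rwa [← support_indicator] at hfin

variable {X : Type u} [Groupoid.{v} X]

/-- The action of a function on arrows on functions on the unit space, obtained by extending
linearly the partial bijections `d g ↦ r g`. -/
noncomputable def augmentation (f : Arr X → ℂ) (h : unitSpace X → ℂ) (u : unitSpace X) : ℂ :=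
  ∑ᶠ a ∈ {a : Arr X | r a = u}, f a * h (dMap a)

theorem augmentation_rMap (f : Arr X → ℂ) (h : unitSpace X → ℂ) (γ : Arr X) :
    augmentation f h (rMap γ) = conv f (h ∘ rMap) γ :=
  finsum_mem_congr rfl fun a ha => by
    rw [Function.comp_apply, show rMap (a⁻¹ * γ) = dMap a from Subtype.ext (r_inv_mul ha)]

theorem augmentation_indicator_rMap {B : Set (Arr X)} (hB : InjOn r B) (h : unitSpace X → ℂ)
    {b : Arr X} (hb : b ∈ B) : augmentation (B.indicator 1) h (rMap b) = h (dMap b) := by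
  rw [augmentation_rMap, conv_eq_single rfl fun c hc hne _ =>
    hB (mem_of_indicator_ne_zero hne) hb hc, indicator_of_mem hb, Pi.one_apply, one_mul, ← d_eq]
  rfl

theorem augmentation_indicator_of_notMem {B : Set (Arr X)} (h : unitSpace X → ℂ)
    {u : unitSpace X} (hu : (u : Arr X) ∉ r '' B) : augmentation (B.indicator 1) h u = 0 :=
  finsum_mem_of_eqOn_zero fun a ha =>
    mul_eq_zero_of_left (indicator_of_notMem (fun haB => hu ⟨a, haB, ha⟩) _) _

theorem augmentation_indicator_of_subset_iso {B : Set (Arr X)} (hB : InjOn r B)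
    (hiso : B ⊆ iso X) :
    augmentation (B.indicator 1) = augmentation ((r '' B).indicator 1) := by
  ext h u
  have hrB : r '' (r '' B) = r '' B := image_image r r B
  by_cases hu : (u : Arr X) ∈ r '' B
  · obtain ⟨b, hb, hbu⟩ := hu
    obtain rfl : rMap b = u := Subtype.ext hbu
    rw [augmentation_indicator_rMap hB h hb]
    have hdr : dMap b = dMap (r b) := Subtype.ext (hiso hb)
    rw [hdr]
    exact (augmentation_indicator_rMap
      (injOn_r_unitSpace.mono (image_r_subset_unitSpace B)) h (mem_image_of_mem r hb)).symm
  · rw [augmentation_indicator_of_notMem h hu, augmentation_indicator_of_notMem h (hrB.symm ▸ hu)]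

theorem augmentation_smul (f : Arr X → ℂ) (c : ℂ) (h : unitSpace X → ℂ) :
    augmentation f (c • h) = c • augmentation f h := by
  ext u
  rw [Pi.smul_apply, smul_eq_mul, augmentation, augmentation, mul_finsum_mem]
  exact finsum_mem_congr rfl fun a _ => mul_left_comm _ _ _

theorem augmentation_dMap (f : Arr X → ℂ) (h : unitSpace X → ℂ) (a : Arr X) :
    augmentation f h (dMap a) = ∑ᶠ γ ∈ {γ | r γ = r a}, f (a⁻¹ * γ) * h (dMap γ) := by
  refine (finsum_mem_eq_of_bijOn _ (bijOn_inv_mul a) fun γ hγ => ?_).symm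
  rw [show dMap (a⁻¹ * γ) = dMap γ from Subtype.ext (d_inv_mul (Eq.symm hγ))]

theorem augmentation_zero (h : unitSpace X → ℂ) : augmentation 0 h = 0 :=
  funext fun _ => finsum_mem_of_eqOn_zero fun _ _ => zero_mul _

variable [TopologicalSpace (Arr X)] [T2Space (Arr X)] [IsEtaleGroupoid X]

theorem finite_rFibre_inter_support (f : ConvAlg X) (h : unitSpace X → ℂ) (u : unitSpace X) :
    ({a : Arr X | r a = u} ∩ Function.support fun a => f a * h (dMap a)).Finite := by
  obtain ⟨_, γ, rfl⟩ := u
  exact (finite_support_fibre f γ).subset fun a ha => ⟨left_ne_zero_of_mul ha.2, ha.1⟩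

theorem augmentation_add_left (f g : ConvAlg X) (h : unitSpace X → ℂ) :
    augmentation ⇑(f + g) h = augmentation f h + augmentation g h := by
  ext u
  refine (finsum_mem_congr rfl fun a _ => add_mul (f a) (g a) _).trans ?_
  exact finsum_mem_add_distrib' (finite_rFibre_inter_support f h u)
    (finite_rFibre_inter_support g h u)

theorem augmentation_add_right (f : ConvAlg X) (h k : unitSpace X → ℂ) :
    augmentation f (h + k) = augmentation f h + augmentation f k := by
  ext u
  refine (finsum_mem_congr rfl fun a _ => mul_add (f a) _ _).trans ?_
  exact finsum_mem_add_distrib' (finite_rFibre_inter_support f h u)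
    (finite_rFibre_inter_support f k u)

theorem augmentation_mul (f g : ConvAlg X) (h : unitSpace X → ℂ) :
    augmentation ⇑(f * g) h = augmentation f (augmentation g h) := by
  ext u
  obtain ⟨_, γ₀, rfl⟩ := u
  obtain ⟨S, hS, hfS⟩ := ConvAlg.finite_left f γ₀
  calc ∑ᶠ γ ∈ {γ | r γ = r γ₀}, (f * g) γ * h (dMap γ)
      = ∑ᶠ γ ∈ {γ | r γ = r γ₀}, ∑ a ∈ S, f a * (g (a⁻¹ * γ) * h (dMap γ)) := ?_
    _ = ∑ a ∈ S, ∑ᶠ γ ∈ {γ | r γ = r γ₀}, f a * (g (a⁻¹ * γ) * h (dMap γ)) := ?_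
    _ = ∑ a ∈ S, f a * augmentation g h (dMap a) := ?_
    _ = ∑ᶠ a ∈ {a | r a = r γ₀}, f a * augmentation g h (dMap a) := ?_
  · refine finsum_mem_congr rfl fun γ hγ => ?_
    rw [ConvAlg.mul_apply_eq_sum f g γ S (fun a ha => (hS a ha).trans (Eq.symm hγ))
      fun a ha => hfS a (ha.trans hγ), Finset.sum_mul]
    exact Finset.sum_congr rfl fun a _ => mul_assoc _ _ _
  · refine finsum_mem_sum_comm S fun a ha => ?_
    rw [← hS a ha]
    refine (finite_support_fibre g (d a)).of_injOn (f := fun γ => a⁻¹ * γ) ?_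
      ((bijOn_inv_mul a).injOn.mono inter_subset_left)
    exact fun γ hγ => ⟨left_ne_zero_of_mul (right_ne_zero_of_mul hγ.2),
      (bijOn_inv_mul a).mapsTo hγ.1⟩
  · refine Finset.sum_congr rfl fun a ha => ?_
    rw [← mul_finsum_mem, augmentation_dMap, hS a ha]
  · exact (finsum_mem_eq_sum_of_subset _
      (fun a ha => hfS a ha.1 (left_ne_zero_of_mul ha.2)) hS).symm

variable (X) in
/-- The augmentation representation of the convolution algebra on the space of all functions on
the unit space. -/
noncomputable def augmentationRep : ConvAlg X →ₙ+* Module.End ℂ (unitSpace X → ℂ) where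
  toFun f :=
    { toFun := augmentation f
      map_add' := augmentation_add_right f
      map_smul' := augmentation_smul f }
  map_zero' := LinearMap.ext augmentation_zero
  map_add' f g := LinearMap.ext (augmentation_add_left f g)
  map_mul' f g := LinearMap.ext (augmentation_mul f g)

theorem augmentationRep_charFn_ne_zero {B : CompactOpens (Arr X)}
    (hB : InjOn r (B : Set (Arr X))) {b : Arr X} (hb : b ∈ B) :
    augmentationRep X (charFn B) ≠ 0 := fun h0 => by
  have h1 : augmentationRep X (charFn B) 1 (rMap b) = 1 := augmentation_indicator_rMap hB 1 hb
  rw [h0] at h1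
  exact zero_ne_one h1

theorem augmentationRep_charFn_of_subset_iso {B : CompactOpens (Arr X)}
    (hB : InjOn r (B : Set (Arr X))) (hiso : (B : Set (Arr X)) ⊆ iso X) :
    augmentationRep X (charFn B) =
      augmentationRep X (charFn (B.map r continuous_r isOpenMap_r)) :=
  LinearMap.ext fun h => congrFun (augmentation_indicator_of_subset_iso hB hiso) h

end Augmentation

/-! ### Consequences of simplicity -/

theorem eq_top_of_mem_of_ne_zero {R : Type*} [NonUnitalNonAssocRing R] [IsSimpleRing R]
    {I : TwoSidedIdeal R} {x : R} (hx : x ∈ I) (hx0 : x ≠ 0) : I = ⊤ :=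
  (IsSimpleRing.simple.eq_bot_or_eq_top I).resolve_left fun h =>
    hx0 ((TwoSidedIdeal.mem_bot _).1 (h ▸ hx))

section Converse

variable {X : Type u} [Groupoid.{v} X] [TopologicalSpace (Arr X)] [T2Space (Arr X)]
  [IsAmpleGroupoid X]

theorem isMinimal_of_isSimpleRing [IsSimpleRing (ConvAlg X)] : IsMinimal X := by
  refine fun U hU hinv => U.eq_empty_or_nonempty.imp_right fun ⟨⟨_, γ, rfl⟩, hγU⟩ => ?_
  obtain ⟨V, hγV, hVU⟩ := exists_compactOpens_subset
    (hU.preimage IsEtaleGroupoid.isLocalHomeomorph_rMap.continuous)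
    (show γ ∈ rMap ⁻¹' U from hγU)
  have htop : idealOfInvariant U hinv = ⊤ :=
    eq_top_of_mem_of_ne_zero (charFn_mem_idealOfInvariant_iff.2 hVU) (charFn_ne_zero hγV)
  refine eq_univ_of_forall fun ⟨_, a, rfl⟩ => ?_
  obtain ⟨W, haW, -⟩ := exists_compactOpens_subset isOpen_univ (mem_univ a)
  have hW : charFn W ∈ idealOfInvariant U hinv := htop.symm ▸ TwoSidedIdeal.mem_top _
  exact charFn_mem_idealOfInvariant_iff.1 hW a haW

theorem injective_augmentationRep_of_isSimpleRing [IsSimpleRing (ConvAlg X)] :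
    Function.Injective (augmentationRep X) := by
  rw [← TwoSidedIdeal.ker_eq_bot]
  refine (IsSimpleRing.simple.eq_bot_or_eq_top _).resolve_right fun htop => ?_
  obtain ⟨f, hf⟩ := exists_ne (0 : ConvAlg X)
  obtain ⟨γ, -⟩ := DFunLike.ne_iff.1 hf
  obtain ⟨B, hB, hγB, -⟩ := exists_compactOpens_isBisection_subset isOpen_univ (mem_univ γ)
  have hker : charFn B ∈ TwoSidedIdeal.ker (augmentationRep X) := htop ▸ TwoSidedIdeal.mem_top _
  exact augmentationRep_charFn_ne_zero hB.injOn_r hγB ((TwoSidedIdeal.mem_ker _).1 hker)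

theorem isEffective_of_injective_augmentationRep
    (hinj : Function.Injective (augmentationRep X)) : IsEffective X := by
  refine Subset.antisymm (interior_maximal unitSpace_subset_iso isOpen_unitSpace) fun g hg => ?_
  obtain ⟨B, hB, hgB, hBiso⟩ := exists_compactOpens_isBisection_subset isOpen_interior hg
  have heq : B = B.map r continuous_r isOpenMap_r := charFn_injective <| hinj <|
    augmentationRep_charFn_of_subset_iso hB.injOn_r (hBiso.trans interior_subset)
  rw [heq] at hgB
  exact image_r_subset_unitSpace _ hgB

end Converse

end AmpleGroupoid

/-- Let `X` be the object set of an ample Hausdorff groupoid (with at least one object). The complex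
convolution ring `C_c(𝒢)` is simple (it has exactly two two-sided ideals) if and only if the groupoid
is minimal and effective. -/
theorem mainTheorem6 (X : Type*) [Nonempty X] [CategoryTheory.Groupoid X]
    [TopologicalSpace (AmpleGroupoid.Arr X)] [AmpleGroupoid.IsAmpleGroupoid X]
    [T2Space (AmpleGroupoid.Arr X)] :
    IsSimpleRing (AmpleGroupoid.ConvAlg X) ↔
      AmpleGroupoid.IsMinimal X ∧ AmpleGroupoid.IsEffective X where
  mp _ := ⟨AmpleGroupoid.isMinimal_of_isSimpleRing,
    AmpleGroupoid.isEffective_of_injective_augmentationRep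
      AmpleGroupoid.injective_augmentationRep_of_isSimpleRing⟩
  mpr h := AmpleGroupoid.isSimpleRing_of_isMinimal_of_isEffective h.1 h.2
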